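/- Let $n_{\mathrm p},n_{\mathrm u},n_{\mathrm y}\ge 0$ and $\mathbb P\subseteq\mathbb R^{n_{\mathrm p}}$. An LPV-SSA $\Sigma$ over $\mathbb P$ with state dimension $n_{\mathrm x}$, input dimension $n_{\mathrm u}$ and output dimension $n_{\mathrm y}$ is given by real matrices $A_i,B_i,C_i,D_i$ ($i=0,\dots,n_{\mathrm p}$) of sizes $n_{\mathrm x}\times n_{\mathrm x}$, $n_{\mathrm x}\times n_{\mathrm u}$, $n_{\mathrm y}\times n_{\mathrm x}$, $n_{\mathrm y}\times n_{\mathrm u}$. Put $A(\mathbf p)=A_0+\sum_{i=1}^{n_{\mathrm p}}\mathbf p_iA_i$, and similarly $B(\mathbf p),C(\mathbf p),D(\mathbf p)$, and consider $$\xi x(t)=A(p(t))x(t)+B(p(t))u(t),\qquad y(t)=C(p(t))x(t)+D(p(t))u(t),\qquad t\in\mathbb T. \tag{1}$$ *Continuous time (CT):* $\mathbb T=[0,\infty)$ and $\xi=\frac{d}{dt}$; the inputs $u\in\mathcal U$, outputs $y\in\mathcal Y$ and scheduling signals $p\in\mathcal P$ are the piecewise continuous functions on $[0,\infty)$ (finitely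 many discontinuities on each bounded interval, finite one-sided limits everywhere) with values in $\mathbb R^{n_{\mathrm u}}$, $\mathbb R^{n_{\mathrm y}}$ and $\mathbb P$; the state trajectories $x\in\mathcal X$ are the functions $[0,\infty)\to\mathbb R^{n_{\mathrm x}}$ that are absolutely continuous on every $[0,T]$. A solution is a tuple $(x,y,u,p)\in\mathcal X\times\mathcal Y\times\mathcal U\times\mathcal P$ satisfying (1) for almost all $t$. *Discrete time (DT):* $\mathbb T=\mathbb N$ and $\xi x(t)=x(t+1)$; $\mathcal X,\mathcal Y,\mathcal U,\mathcal P$ are the sets of all sequences with values in $\mathbb R^{n_{\mathrm x}},\mathbb R^{n_{\mathrm y}},\mathbb R^{n_{\mathrm u}},\mathbb P$. A solution satisfies (1) for all $t$. The manifest behavior $\mathcal B(\Sigma)$ is the set of all $(y,u,p)\in\mathcal Y\times\mathcal U\times\mathcal P$ for which there is $x\in\mathcal X$ such that $(x,y,u,p)$ is a solution. For $x_0\in\mathbb R^{n_{\mathrm x}}$, the i/o function $\mathfrak Y_{\Sigma,x_0}$ on $\mathcal U\times\mathcal P$ is determined by: $y=\mathfrak Y_{\Sigma,x_0}(u,p)$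 if and only if there is a solution $(x,y,u,p)$ with $x(0)=x_0$; in CT its values are outputs up to equality almost everywhere. The family of i/o functions is $\mathbb F(\Sigma)=\{\mathfrak Y_{\Sigma,x_0}\mid x_0\in\mathbb R^{n_{\mathrm x}}\}$. $\Sigma$ satisfies RC if $\mathbb P$ is convex with non-empty interior and, in DT, moreover $A(\mathbf p)$ is invertible for every $\mathbf p\in\mathbb P$. **Theorem.** In CT as well as in DT: let $\Sigma$ and $\hat\Sigma$ be two LPV-SSAs over the same $\mathbb P$, with the same $n_{\mathrm u}$ and $n_{\mathrm y}$ (and possibly different state dimensions), which both satisfy RC. Then $$\mathbb F(\Sigma)=\mathbb F(\hat\Sigma)\iff\mathcal B(\Sigma)=\mathcal B(\hat\Sigma).$$ This fails in DT without RC. With $\mathbb P=\mathbb R$, $n_{\mathrm y}=1$ and any $n_{\mathrm u}$, let $\Sigma$ be the system $x_1(t+1)=x_1(t)+p(t)x_2(t)$, $x_2(t+1)=0$, $y(t)=x_1(t)+p(t)x_2(t)$, and let $\Sigma'$ be the system $z(t+1)=z(t)$, $y(t)=z(t)$. Then $\Sigma$ does not satisfy RC, $\Sigma'$ does, $\mathcal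 B(\Sigma)=\mathcal B(\Sigma')$, but $\mathbb F(\Sigma)\neq\mathbb F(\Sigma')$. -/

import Mathlib

open MeasureTheory Set Filter Topology
open scoped NNReal Matrix

/-- A linear parameter-varying state-space representation with affine dependence (LPV-SSA) over the
scheduling space `P ⊆ ℝ^np`, with state dimension `nx`, input dimension `nu` and output dimension
`ny`.  Each family of matrices is indexed by `0, 1, …, np`. -/
structure LPVSSA {np : ℕ} (P : Set (Fin np → ℝ)) (nx nu ny : ℕ) where
  A : Fin (np + 1) → Matrix (Fin nx) (Fin nx) ℝ
  B : Fin (np + 1) → Matrix (Fin nx) (Fin nu) ℝ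
  C : Fin (np + 1) → Matrix (Fin ny) (Fin nx) ℝ
  D : Fin (np + 1) → Matrix (Fin ny) (Fin nu) ℝ

/-- The affine matrix function `M(p) = M₀ + ∑ᵢ pᵢ Mᵢ`. -/
def affineMatrix {np m n : ℕ} (M : Fin (np + 1) → Matrix (Fin m) (Fin n) ℝ) (p : Fin np → ℝ) :
    Matrix (Fin m) (Fin n) ℝ :=
  M 0 + ∑ i : Fin np, p i • M i.succ

namespace LPVSSA

variable {np : ℕ} {P : Set (Fin np → ℝ)} {nx nu ny : ℕ}

/-- The right-hand side `A(p) x + B(p) u` of the state equation. -/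
def stateMap (S : LPVSSA P nx nu ny) (p : Fin np → ℝ) (x : Fin nx → ℝ) (u : Fin nu → ℝ) :
    Fin nx → ℝ :=
  affineMatrix S.A p *ᵥ x + affineMatrix S.B p *ᵥ u

/-- The right-hand side `C(p) x + D(p) u` of the output equation. -/
def outputMap (S : LPVSSA P nx nu ny) (p : Fin np → ℝ) (x : Fin nx → ℝ) (u : Fin nu → ℝ) :
    Fin ny → ℝ :=
  affineMatrix S.C p *ᵥ x + affineMatrix S.D p *ᵥ u

end LPVSSA

/-! Continuous time: the time axis is `[0, ∞)`. -/

namespace CT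

/-- Piecewise continuity on `[0, ∞)`: finitely many discontinuities on every bounded interval,
and finite one-sided limits at every point. (At `0` the left-hand condition is void.) -/
def PiecewiseContinuous {n : ℕ} (f : ℝ≥0 → (Fin n → ℝ)) : Prop :=
  (∀ T : ℝ≥0, {t : ℝ≥0 | t ≤ T ∧ ¬ ContinuousAt f t}.Finite) ∧
  ∀ t : ℝ≥0, (∃ l, Tendsto f (𝓝[<] t) (𝓝 l)) ∧ (∃ l, Tendsto f (𝓝[>] t) (𝓝 l))

/-- The piecewise continuous signals `[0, ∞) → ℝⁿ` (inputs and outputs). -/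
abbrev Signal (n : ℕ) : Type := {f : ℝ≥0 → (Fin n → ℝ) // PiecewiseContinuous f}

/-- The scheduling signals: piecewise continuous signals with values in `P`. -/
abbrev Scheduling {np : ℕ} (P : Set (Fin np → ℝ)) : Type :=
  {p : ℝ≥0 → (Fin np → ℝ) // PiecewiseContinuous p ∧ ∀ t, p t ∈ P}

/-- A function on `[0, ∞)` extended to `ℝ` by its value at `0`. -/
def extend {n : ℕ} (x : ℝ≥0 → (Fin n → ℝ)) (s : ℝ) : Fin n → ℝ := x s.toNNReal

/-- The state trajectories: functions `[0, ∞) → ℝⁿ` that are absolutely continuous on every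
interval `[0, T]`. -/
abbrev StateTrajectory (n : ℕ) : Type :=
  {x : ℝ≥0 → (Fin n → ℝ) // ∀ T : ℝ≥0, AbsolutelyContinuousOnInterval (extend x) 0 T}

/-- "For almost all `t ∈ [0, ∞)`", with respect to Lebesgue measure. -/
def ForAlmostAll (Q : ℝ≥0 → Prop) : Prop :=
  ∀ᵐ s ∂(volume.restrict (Ici (0 : ℝ))), Q s.toNNReal

/-- Output signals are identified when they agree almost everywhere. -/
def outputSetoid (ny : ℕ) : Setoid (Signal ny) where
  r y y' := ForAlmostAll fun t => y.1 t = y'.1 t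
  iseqv :=
    { refl := fun _ => Eventually.of_forall fun _ => rfl
      symm := fun h => Eventually.mono h fun _ e => e.symm
      trans := fun h h' => Eventually.mp h (Eventually.mono h' fun _ e' e => e.trans e') }

/-- Output trajectories up to equality almost everywhere. -/
abbrev OutputClass (ny : ℕ) : Type := Quotient (outputSetoid ny)

variable {np : ℕ} {P : Set (Fin np → ℝ)} {nx nu ny : ℕ}

/-- `(x, y, u, p)` is a solution: the state and the output equation hold for almost all `t`.
(For `t > 0` a derivative of the extension of `x` to `ℝ` is the same as a derivative of `x`.) -/
def IsSolution (S : LPVSSA P nx nu ny) (x : StateTrajectory nx) (y : Signal ny) (u : Signal nu)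
    (p : Scheduling P) : Prop :=
  ForAlmostAll fun t =>
    HasDerivAt (extend x.1) (S.stateMap (p.1 t) (x.1 t) (u.1 t)) (t : ℝ) ∧
    y.1 t = S.outputMap (p.1 t) (x.1 t) (u.1 t)

/-- The manifest behavior. -/
def behavior (S : LPVSSA P nx nu ny) : Set (Signal ny × Signal nu × Scheduling P) :=
  {w | ∃ x : StateTrajectory nx, IsSolution S x w.1 w.2.1 w.2.2}

/-- `F` is the input-output function induced by the initial state `x₀`: `y = F(u, p)` if and only
if there is a solution `(x, y, u, p)` with `x(0) = x₀`. -/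
def IsIOFunction (S : LPVSSA P nx nu ny) (x₀ : Fin nx → ℝ)
    (F : Signal nu × Scheduling P → OutputClass ny) : Prop :=
  ∀ (u : Signal nu) (p : Scheduling P) (y : Signal ny),
    Quotient.mk (outputSetoid ny) y = F (u, p) ↔
      ∃ x : StateTrajectory nx, IsSolution S x y u p ∧ x.1 0 = x₀

/-- The family of input-output functions, over all initial states. -/
def ioFamily (S : LPVSSA P nx nu ny) : Set (Signal nu × Scheduling P → OutputClass ny) :=
  {F | ∃ x₀ : Fin nx → ℝ, IsIOFunction S x₀ F}

/-- The regularity certificate in continuous time (a condition on `P` only). -/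
def RC (_S : LPVSSA P nx nu ny) : Prop :=
  Convex ℝ P ∧ (interior P).Nonempty

end CT

/-! Discrete time: the time axis is `ℕ`. -/

namespace DT

/-- Arbitrary sequences in `ℝⁿ` (states, inputs and outputs). -/
abbrev Signal (n : ℕ) : Type := ℕ → (Fin n → ℝ)

/-- The scheduling signals: sequences in `P`. -/
abbrev Scheduling {np : ℕ} (P : Set (Fin np → ℝ)) : Type := ℕ → P

variable {np : ℕ} {P : Set (Fin np → ℝ)} {nx nu ny : ℕ}

/-- `(x, y, u, p)` is a solution: the state and the output equation hold for all `t`. -/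
def IsSolution (S : LPVSSA P nx nu ny) (x : Signal nx) (y : Signal ny) (u : Signal nu)
    (p : Scheduling P) : Prop :=
  ∀ t : ℕ, x (t + 1) = S.stateMap (p t) (x t) (u t) ∧ y t = S.outputMap (p t) (x t) (u t)

/-- The manifest behavior. -/
def behavior (S : LPVSSA P nx nu ny) : Set (Signal ny × Signal nu × Scheduling P) :=
  {w | ∃ x : Signal nx, IsSolution S x w.1 w.2.1 w.2.2}

/-- `F` is the input-output function induced by the initial state `x₀`: `y = F(u, p)` if and only
if there is a solution `(x, y, u, p)` with `x(0) = x₀`. -/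
def IsIOFunction (S : LPVSSA P nx nu ny) (x₀ : Fin nx → ℝ)
    (F : Signal nu × Scheduling P → Signal ny) : Prop :=
  ∀ (u : Signal nu) (p : Scheduling P) (y : Signal ny),
    y = F (u, p) ↔ ∃ x : Signal nx, IsSolution S x y u p ∧ x 0 = x₀

/-- The family of input-output functions, over all initial states. -/
def ioFamily (S : LPVSSA P nx nu ny) : Set (Signal nu × Scheduling P → Signal ny) :=
  {F | ∃ x₀ : Fin nx → ℝ, IsIOFunction S x₀ F}

/-- The regularity certificate in discrete time. -/
def RC (S : LPVSSA P nx nu ny) : Prop :=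
  (Convex ℝ P ∧ (interior P).Nonempty) ∧ ∀ p ∈ P, IsUnit (affineMatrix S.A p)

/-- The system `x₁(t+1) = x₁(t) + p(t) x₂(t)`, `x₂(t+1) = 0`, `y(t) = x₁(t) + p(t) x₂(t)`
with scheduling space `ℝ`; the input does not enter. -/
def exampleSystem (nu : ℕ) : LPVSSA (univ : Set (Fin 1 → ℝ)) 2 nu 1 where
  A := ![!![1, 0; 0, 0], !![0, 1; 0, 0]]
  B := 0
  C := ![!![1, 0], !![0, 1]]
  D := 0

/-- The system `z(t+1) = z(t)`, `y(t) = z(t)` with scheduling space `ℝ`; the input does not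
enter. -/
def exampleSystem' (nu : ℕ) : LPVSSA (univ : Set (Fin 1 → ℝ)) 1 nu 1 where
  A := ![!![1], !![0]]
  B := 0
  C := ![!![1], !![0]]
  D := 0

end DT

/-! A behavior is the union of the graphs of the i/o functions up to the identification of outputs,
so equal families have equal behaviors. Conversely, equal behaviors say that for each state `x` of
the first system and all signals `(u, p)` some state `x'` of the second has the same output. The
difficulty is that `x'` may depend on the signals.

The pairs of initial states whose outputs agree before a given horizon form an affine relation. For
zero input it is a linear subspace, which shrinks when the scheduling is prolonged. Choose a
scheduling `q` and a horizon `T` for which its dimension is minimal; prolonging `q` beyond `T` then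
imposes no further constraint on zero-input pairs. Given `x₁`, find `x` that the zero-input flow
along `q` carries to `x₁` at time `T`, take a partner `x'` of `x` for zero input and `q`, and let
`x₁'` be the state reached from `x'` at time `T`. For arbitrary `(u, r)`, the signal `(0, q)`
followed by `(u, r)` admits a partner `y'` of the state `0`. Both `(x, x')` and `(0, y')` lie in the
minimal subspace, so their difference still agrees along the prolonged zero-input signal. By
superposition `(x, x')` agrees along the concatenation, and after `T` this says that `x₁` and `x₁'`
agree under `(u, r)`.

Finding `x` requires the zero-input flow to be onto: RC gives this in discrete time, backward
uniqueness for linear differential equations in continuous time. There the state equation is studied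
in integrated form, by Neumann series and Grönwall estimates. -/

/-- A family of affine relations between two state spaces that is compatible with concatenation of
signals and onto the first state space contains the graph of a relation that does not depend on the
signals. The proof chooses signals for which the homogeneous relation has minimal dimension. -/
theorem exists_uniform_partner {E E' U Q τ : Type*} [AddCommGroup E] [Module ℝ E]
    [FiniteDimensional ℝ E] [AddCommGroup E'] [Module ℝ E'] [FiniteDimensional ℝ E']
    [Nonempty Q] [Nonempty τ] (Ag : U → Q → τ → Set (E × E')) (o : U)
    (Φ : Q → τ → E → E) (Φ' : Q → τ → E' → E')
    (hzero : ∀ q t, (0 : E × E') ∈ Ag o q t)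
    (hlin : ∀ u q t a b (c : ℝ), a ∈ Ag u q t → b ∈ Ag o q t → a + c • b ∈ Ag u q t)
    (hcat : ∀ q T u r t, ∃ u' q' t', Ag o q' t' ⊆ Ag o q T ∧ Ag u' q' t' ⊆ Ag o q T ∧
      ∀ a ∈ Ag u' q' t', (Φ q T a.1, Φ' q T a.2) ∈ Ag u r t)
    (hne : ∀ u q x, ∃ x', ∀ t, (x, x') ∈ Ag u q t)
    (hsurj : ∀ q T, Function.Surjective (Φ q T)) (x₁ : E) :
    ∃ x₁', ∀ u q t, (x₁, x₁') ∈ Ag u q t := by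
  let V : Q × τ → Submodule ℝ (E × E') := fun w =>
    { carrier := Ag o w.1 w.2
      zero_mem' := hzero _ _
      add_mem' := fun {a b} ha hb => by simpa using hlin o w.1 w.2 a b 1 ha hb
      smul_mem' := fun c a ha => by simpa using hlin o w.1 w.2 0 a c (hzero _ _) ha }
  obtain ⟨⟨q, T⟩, hmin⟩ : ∃ w, ∀ w', Module.finrank ℝ (V w) ≤ Module.finrank ℝ (V w') :=
    ⟨Function.argmin fun w => Module.finrank ℝ (V w),
      fun w' => Function.argmin_le (fun w => Module.finrank ℝ (V w)) w'⟩
  -- The given state is reached at time `T` from `x`; its partner is the state reached from a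
  -- partner of `x`, chosen before `u`, `r`, `t` are introduced.
  obtain ⟨x, rfl⟩ := hsurj q T x₁
  obtain ⟨x', hx'⟩ := hne o q x
  refine ⟨Φ' q T x', fun u r t => ?_⟩
  obtain ⟨u', q', t', hV, hA, hΦ⟩ := hcat q T u r t
  -- Prolonging can only shrink the subspace, and minimality forbids a drop in dimension.
  have hVeq : V (q', t') = V (q, T) := Submodule.eq_of_le_of_finrank_le hV (hmin _)
  -- A partner of the zero state accounts for the inhomogeneous effect of the input `u'`.
  obtain ⟨y', hy'⟩ := hne u' q' 0
  have hb : (x, x') - (0, y') ∈ V (q', t') := by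
    rw [hVeq]
    exact (V (q, T)).sub_mem (hx' T) (hA (hy' t'))
  have ha : (x, x') ∈ Ag u' q' t' := by
    simpa using hlin u' q' t' (0, y') _ 1 (hy' t') hb
  exact hΦ _ ha

/-! ### Joint linearity in state and input -/

namespace LPVSSA

variable {np : ℕ} {P : Set (Fin np → ℝ)} {nx nu ny : ℕ}

/-- The combination `x + c • y` covers additivity (`c = 1`) as well as vanishing at zero (zero
arguments with `c = -1`). -/
theorem stateMap_add_smul (S : LPVSSA P nx nu ny) (p : Fin np → ℝ) (x y : Fin nx → ℝ)
    (u v : Fin nu → ℝ) (c : ℝ) :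
    S.stateMap p (x + c • y) (u + c • v) = S.stateMap p x u + c • S.stateMap p y v := by
  simp only [stateMap, Matrix.mulVec_add, Matrix.mulVec_smul, smul_add]
  abel

theorem outputMap_add_smul (S : LPVSSA P nx nu ny) (p : Fin np → ℝ) (x y : Fin nx → ℝ)
    (u v : Fin nu → ℝ) (c : ℝ) :
    S.outputMap p (x + c • y) (u + c • v) = S.outputMap p x u + c • S.outputMap p y v := by
  simp only [outputMap, Matrix.mulVec_add, Matrix.mulVec_smul, smul_add]
  abel

end LPVSSA

/-! ### Discrete time: trajectories, concatenation, agreement -/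

namespace DT

variable {np : ℕ} {P : Set (Fin np → ℝ)} {nx nx' nu ny : ℕ}

/-- The state trajectory started at `x₀`. -/
def traj (S : LPVSSA P nx nu ny) (u : Signal nu) (p : Scheduling P) (x₀ : Fin nx → ℝ) :
    Signal nx
  | 0 => x₀
  | t + 1 => S.stateMap (p t) (traj S u p x₀ t) (u t)

/-- The output trajectory with initial state `x₀`. -/
def output (S : LPVSSA P nx nu ny) (u : Signal nu) (p : Scheduling P) (x₀ : Fin nx → ℝ) :
    Signal ny :=
  fun t => S.outputMap (p t) (traj S u p x₀ t) (u t)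

theorem exists_isSolution_iff (S : LPVSSA P nx nu ny) (y : Signal ny) (u : Signal nu)
    (p : Scheduling P) (x₀ : Fin nx → ℝ) :
    (∃ x : Signal nx, IsSolution S x y u p ∧ x 0 = x₀) ↔ y = output S u p x₀ := by
  constructor
  · rintro ⟨x, hx, rfl⟩
    have h : ∀ t, x t = traj S u p (x 0) t := by
      intro t
      induction t with
      | zero => rfl
      | succ t ih => rw [(hx t).1, ih, traj]
    funext t
    rw [(hx t).2, h t, output]
  · rintro rfl
    exact ⟨traj S u p x₀, fun t => ⟨rfl, rfl⟩, rfl⟩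

theorem isIOFunction_iff (S : LPVSSA P nx nu ny) (x₀ : Fin nx → ℝ)
    (F : Signal nu × Scheduling P → Signal ny) :
    IsIOFunction S x₀ F ↔ F = fun w => output S w.1 w.2 x₀ := by
  simp only [IsIOFunction, exists_isSolution_iff]
  constructor
  · intro h
    funext w
    exact (h w.1 w.2 (F w)).1 rfl
  · rintro rfl u p y
    rfl

theorem ioFamily_eq_range (S : LPVSSA P nx nu ny) :
    ioFamily S = range fun x₀ (w : Signal nu × Scheduling P) => output S w.1 w.2 x₀ := by
  ext F
  simp only [ioFamily, isIOFunction_iff, mem_range, eq_comm]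
  rfl

theorem mem_behavior_iff (S : LPVSSA P nx nu ny) (w : Signal ny × Signal nu × Scheduling P) :
    w ∈ behavior S ↔ ∃ x₀, w.1 = output S w.2.1 w.2.2 x₀ := by
  simp only [← exists_isSolution_iff]
  exact ⟨fun ⟨x, hx⟩ => ⟨x 0, x, hx, rfl⟩, fun ⟨_, x, hx, _⟩ => ⟨x, hx⟩⟩

theorem traj_add_smul (S : LPVSSA P nx nu ny) (u v : Signal nu) (p : Scheduling P)
    (x y : Fin nx → ℝ) (c : ℝ) (t : ℕ) :
    traj S (u + c • v) p (x + c • y) t = traj S u p x t + c • traj S v p y t := by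
  induction t with
  | zero => rfl
  | succ t ih => exact (congrArg (S.stateMap _ · _) ih).trans (S.stateMap_add_smul ..)

theorem output_add_smul (S : LPVSSA P nx nu ny) (u v : Signal nu) (p : Scheduling P)
    (x y : Fin nx → ℝ) (c : ℝ) (t : ℕ) :
    output S (u + c • v) p (x + c • y) t = output S u p x t + c • output S v p y t := by
  rw [output, traj_add_smul]
  exact S.outputMap_add_smul ..

/-- The signal `w` up to time `T`, followed by the signal `w'`. -/
def concat {α : Type*} (T : ℕ) (w w' : ℕ → α) (t : ℕ) : α :=
  if t < T then w t else w' (t - T)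

theorem concat_of_lt {α : Type*} {T : ℕ} (w w' : ℕ → α) {t : ℕ} (h : t < T) :
    concat T w w' t = w t := if_pos h

theorem concat_add {α : Type*} (T : ℕ) (w w' : ℕ → α) (t : ℕ) :
    concat T w w' (T + t) = w' t := by
  simp [concat]

/-- The state at time `T` depends only on signal values before `T`, so `t = T` is included; the
output at `T` already sees the new signals. -/
theorem traj_concat_of_le (S : LPVSSA P nx nu ny) (T : ℕ) (u v : Signal nu) (p q : Scheduling P)
    (x : Fin nx → ℝ) {t : ℕ} (ht : t ≤ T) :
    traj S (concat T u v) (concat T p q) x t = traj S u p x t := by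
  induction t with
  | zero => rfl
  | succ t ih => simp only [traj, ih (by omega), concat_of_lt _ _ (show t < T by omega)]

theorem output_concat_of_lt (S : LPVSSA P nx nu ny) (T : ℕ) (u v : Signal nu)
    (p q : Scheduling P) (x : Fin nx → ℝ) {t : ℕ} (ht : t < T) :
    output S (concat T u v) (concat T p q) x t = output S u p x t := by
  simp only [output, traj_concat_of_le S T u v p q x ht.le, concat_of_lt _ _ ht]

theorem traj_concat_add (S : LPVSSA P nx nu ny) (T : ℕ) (u v : Signal nu) (p q : Scheduling P)
    (x : Fin nx → ℝ) (t : ℕ) :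
    traj S (concat T u v) (concat T p q) x (T + t) = traj S v q (traj S u p x T) t := by
  induction t with
  | zero => exact traj_concat_of_le S T u v p q x le_rfl
  | succ t ih =>
    rw [← add_assoc]
    simp only [traj, ih, concat_add]

theorem output_concat_add (S : LPVSSA P nx nu ny) (T : ℕ) (u v : Signal nu) (p q : Scheduling P)
    (x : Fin nx → ℝ) (t : ℕ) :
    output S (concat T u v) (concat T p q) x (T + t) = output S v q (traj S u p x T) t := by
  simp only [output, traj_concat_add, concat_add]

/-- With zero input each step multiplies the state by an invertible matrix `A(p t)`. -/
theorem traj_zero_surjective (S : LPVSSA P nx nu ny)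
    (hS : ∀ p ∈ P, IsUnit (affineMatrix S.A p)) (p : Scheduling P) (t : ℕ) :
    Function.Surjective fun x => traj S 0 p x t := by
  induction t with
  | zero => exact fun x => ⟨x, rfl⟩
  | succ t ih =>
    intro y
    obtain ⟨z, hz⟩ := (Matrix.mulVec_surjective_iff_isUnit.2 (hS (p t) (p t).2)) y
    obtain ⟨x, hx⟩ := ih z
    refine ⟨x, ?_⟩
    simp only at hx
    simp [traj, hx, LPVSSA.stateMap, hz]

/-- The pairs of initial states whose outputs agree before time `t`. -/
def agree (S : LPVSSA P nx nu ny) (S' : LPVSSA P nx' nu ny) (u : Signal nu) (p : Scheduling P)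
    (t : ℕ) : Set ((Fin nx → ℝ) × (Fin nx' → ℝ)) :=
  {a | ∀ s < t, output S u p a.1 s = output S' u p a.2 s}

theorem agree_add_smul {S : LPVSSA P nx nu ny} {S' : LPVSSA P nx' nu ny} {u v : Signal nu}
    {p : Scheduling P} {t : ℕ} {a b : (Fin nx → ℝ) × (Fin nx' → ℝ)} (c : ℝ)
    (ha : a ∈ agree S S' u p t) (hb : b ∈ agree S S' v p t) :
    a + c • b ∈ agree S S' (u + c • v) p t := by
  intro s hs
  simp only [Prod.fst_add, Prod.smul_fst, Prod.snd_add, Prod.smul_snd, output_add_smul, ha s hs,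
    hb s hs]

theorem zero_mem_agree (S : LPVSSA P nx nu ny) (S' : LPVSSA P nx' nu ny) (p : Scheduling P)
    (t : ℕ) : 0 ∈ agree S S' 0 p t := by
  intro s _
  have h : ∀ {n : ℕ} (R : LPVSSA P n nu ny), output R 0 p 0 s = 0 := fun R => by
    simpa using output_add_smul R 0 0 p 0 0 (-1) s
  exact (h S).trans (h S').symm

theorem ioFamily_subset_of_behavior_eq (S : LPVSSA P nx nu ny) (S' : LPVSSA P nx' nu ny)
    (hP : P.Nonempty) (hS : ∀ p ∈ P, IsUnit (affineMatrix S.A p))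
    (h : behavior S = behavior S') : ioFamily S ⊆ ioFamily S' := by
  have : Nonempty (Scheduling P) := ⟨fun _ => ⟨_, hP.some_mem⟩⟩
  rw [ioFamily_eq_range, ioFamily_eq_range]
  rintro _ ⟨x₀, rfl⟩
  obtain ⟨x₀', h'⟩ := exists_uniform_partner (agree S S') 0 (fun p t x => traj S 0 p x t)
    (fun p t x => traj S' 0 p x t) (zero_mem_agree S S')
    (fun u q t a b c ha hb => by simpa using agree_add_smul c ha hb)
    (fun p T u q t => by
      refine ⟨concat T 0 u, concat T p q, T + t, fun a ha s hs => ?_, fun a ha s hs => ?_,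
        fun a ha s hs => ?_⟩
      -- The linear relation of the prolonged scheduling has zero input throughout, so zero must be
      -- read as a concatenation of zeros.
      · have hc : concat T (0 : Signal nu) 0 = 0 := by
          funext s
          simp [concat]
        have := ha s (by omega)
        rw [← hc] at this
        simpa only [output_concat_of_lt _ _ _ _ _ _ _ hs] using this
      · simpa only [output_concat_of_lt _ _ _ _ _ _ _ hs] using ha s (by omega)
      · simpa only [output_concat_add] using ha (T + s) (by omega))
    (fun u p x => by
      have : (output S u p x, u, p) ∈ behavior S' := by
        rw [← h, mem_behavior_iff]
        exact ⟨x, rfl⟩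
      obtain ⟨x', hx'⟩ := (mem_behavior_iff _ _).1 this
      exact ⟨x', fun t s _ => congrFun hx' s⟩)
    (traj_zero_surjective S hS) x₀
  refine ⟨x₀', ?_⟩
  funext w t
  -- Agreement is required strictly before the horizon, so time `t` needs horizon `t + 1`.
  exact (h' w.1 w.2 (t + 1) t (Nat.lt_succ_self t)).symm

theorem behavior_subset_of_ioFamily_eq (S : LPVSSA P nx nu ny) (S' : LPVSSA P nx' nu ny)
    (h : ioFamily S = ioFamily S') : behavior S ⊆ behavior S' := by
  intro w hw
  obtain ⟨x₀, hx₀⟩ := (mem_behavior_iff _ _).1 hw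
  rw [ioFamily_eq_range, ioFamily_eq_range] at h
  obtain ⟨x₀', hx₀'⟩ := h.subset ⟨x₀, rfl⟩
  rw [mem_behavior_iff]
  exact ⟨x₀', hx₀.trans (congrFun hx₀' w.2).symm⟩

theorem ioFamily_eq_iff_behavior_eq (S : LPVSSA P nx nu ny) (S' : LPVSSA P nx' nu ny)
    (hS : RC S) (hS' : RC S') : ioFamily S = ioFamily S' ↔ behavior S = behavior S' := by
  have hP : P.Nonempty := hS.1.2.mono interior_subset
  exact ⟨fun h => (behavior_subset_of_ioFamily_eq S S' h).antisymm
      (behavior_subset_of_ioFamily_eq S' S h.symm),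
    fun h => (ioFamily_subset_of_behavior_eq S S' hP hS.2 h).antisymm
      (ioFamily_subset_of_behavior_eq S' S hP hS'.2 h.symm)⟩

/-! ### The discrete-time counterexample -/

section Example

variable (nu : ℕ)

theorem exampleSystem_stateMap (p : Fin 1 → ℝ) (x : Fin 2 → ℝ) (u : Fin nu → ℝ) :
    (exampleSystem nu).stateMap p x u = ![x 0 + p 0 * x 1, 0] := by
  ext i
  fin_cases i <;>
  simp [LPVSSA.stateMap, exampleSystem, affineMatrix, dotProduct, Fin.sum_univ_two]

theorem exampleSystem_outputMap (p : Fin 1 → ℝ) (x : Fin 2 → ℝ) (u : Fin nu → ℝ) :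
    (exampleSystem nu).outputMap p x u = ![x 0 + p 0 * x 1] := by
  ext i
  fin_cases i
  simp [LPVSSA.outputMap, exampleSystem, affineMatrix, dotProduct, Fin.sum_univ_two]

theorem exampleSystem'_stateMap (p : Fin 1 → ℝ) (x : Fin 1 → ℝ) (u : Fin nu → ℝ) :
    (exampleSystem' nu).stateMap p x u = x := by
  ext i
  fin_cases i
  simp [LPVSSA.stateMap, exampleSystem', affineMatrix, dotProduct]

theorem exampleSystem'_outputMap (p : Fin 1 → ℝ) (x : Fin 1 → ℝ) (u : Fin nu → ℝ) :
    (exampleSystem' nu).outputMap p x u = x := by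
  ext i
  fin_cases i
  simp [LPVSSA.outputMap, exampleSystem', affineMatrix, dotProduct]

/-- The first step adds `p(0) x₂(0)` to `x₁` and annihilates `x₂`; from then on `x₁` is frozen at
the value already shown by the first output. -/
theorem output_exampleSystem (u : Signal nu) (p : Scheduling (univ : Set (Fin 1 → ℝ)))
    (x : Fin 2 → ℝ) (t : ℕ) :
    output (exampleSystem nu) u p x t = ![x 0 + (p 0 : Fin 1 → ℝ) 0 * x 1] := by
  have h : ∀ t, traj (exampleSystem nu) u p x (t + 1) =
      ![x 0 + (p 0 : Fin 1 → ℝ) 0 * x 1, 0] := by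
    intro t
    induction t with
    | zero => simp [traj, exampleSystem_stateMap]
    | succ t ih => rw [traj, ih, exampleSystem_stateMap]; simp
  cases t with
  | zero => simp [output, exampleSystem_outputMap, traj]
  | succ t => simp [output, exampleSystem_outputMap, h]

theorem output_exampleSystem' (u : Signal nu) (p : Scheduling (univ : Set (Fin 1 → ℝ)))
    (x : Fin 1 → ℝ) (t : ℕ) : output (exampleSystem' nu) u p x t = x := by
  have h : traj (exampleSystem' nu) u p x t = x := by
    induction t with
    | zero => rfl
    | succ t ih => rw [traj, ih, exampleSystem'_stateMap]
  rw [output, h, exampleSystem'_outputMap]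

theorem not_rc_exampleSystem : ¬ RC (exampleSystem nu) := by
  rintro ⟨-, h⟩
  have h0 := (Matrix.isUnit_iff_isUnit_det _).1 (h 0 (mem_univ _))
  simp [exampleSystem, affineMatrix, Matrix.det_fin_two] at h0

theorem rc_exampleSystem' : RC (exampleSystem' nu) := by
  refine ⟨⟨convex_univ, by simp⟩, fun p _ => ?_⟩
  rw [Matrix.isUnit_iff_isUnit_det]
  simp [exampleSystem', affineMatrix]

theorem behavior_exampleSystem_eq :
    behavior (exampleSystem nu) = behavior (exampleSystem' nu) := by
  ext ⟨y, u, p⟩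
  simp only [mem_behavior_iff]
  constructor
  · rintro ⟨x, rfl⟩
    refine ⟨![x 0 + (p 0 : Fin 1 → ℝ) 0 * x 1], ?_⟩
    funext t
    rw [output_exampleSystem, output_exampleSystem']
  · rintro ⟨x, rfl⟩
    -- A vanishing second coordinate removes the dependence on `p`.
    refine ⟨![x 0, 0], ?_⟩
    funext t
    rw [output_exampleSystem, output_exampleSystem']
    ext i
    fin_cases i
    simp

/-- The initial state `(0, 1)` has the constant output `p(0)`, which varies with the scheduling
signal; each i/o function of the other system is independent of it. -/
theorem ioFamily_exampleSystem_ne :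
    ioFamily (exampleSystem nu) ≠ ioFamily (exampleSystem' nu) := by
  intro h
  rw [ioFamily_eq_range, ioFamily_eq_range] at h
  obtain ⟨z, hz⟩ := h.subset ⟨![0, 1], rfl⟩
  have key : ∀ c : ℝ, z 0 = c := fun c => by
    have := congrFun (congrFun (congrFun hz (0, fun _ => ⟨fun _ => c, mem_univ _⟩)) 0) 0
    simpa [output_exampleSystem, output_exampleSystem'] using this
  exact zero_ne_one ((key 0).symm.trans (key 1))

end Example

end DT

/-! ### Locally bounded measurable functions and their primitives -/

/-- A measurable function on the line that is bounded on bounded intervals. -/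
structure LocallyBoundedMeasurable {F : Type*} [NormedAddCommGroup F] (f : ℝ → F) : Prop where
  aestronglyMeasurable : AEStronglyMeasurable f volume
  exists_bound : ∀ T : ℝ, ∃ C : ℝ, ∀ s ∈ Icc (-T) T, ‖f s‖ ≤ C

namespace LocallyBoundedMeasurable

variable {E F : Type*} [NormedAddCommGroup E] [NormedAddCommGroup F]

theorem of_continuous {f : ℝ → F} (hf : Continuous f) : LocallyBoundedMeasurable f :=
  ⟨hf.aestronglyMeasurable, fun _ => isCompact_Icc.exists_bound_of_continuousOn hf.continuousOn⟩

theorem clm_apply [NormedSpace ℝ E] [NormedSpace ℝ F] {a : ℝ → E →L[ℝ] F} {f : ℝ → E}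
    (ha : LocallyBoundedMeasurable a) (hf : LocallyBoundedMeasurable f) :
    LocallyBoundedMeasurable fun s => a s (f s) := by
  refine ⟨isBoundedBilinearMap_apply.continuous.comp_aestronglyMeasurable₂ ha.1 hf.1,
    fun T => ?_⟩
  obtain ⟨C, hC⟩ := ha.2 T
  obtain ⟨D, hD⟩ := hf.2 T
  exact ⟨C * D, fun s hs => (a s).le_of_opNorm_le_of_le (hC s hs) (hD s hs)⟩

theorem intervalIntegrable {f : ℝ → F} (hf : LocallyBoundedMeasurable f) (a b : ℝ) :
    IntervalIntegrable f volume a b := by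
  obtain ⟨C, hC⟩ := hf.2 (max |a| |b|)
  rw [intervalIntegrable_iff]
  refine Measure.integrableOn_of_bounded (M := C) measure_Ioc_lt_top.ne hf.1 ?_
  refine (ae_restrict_iff' measurableSet_uIoc).2 (ae_of_all _ fun s hs => hC s ?_)
  have hs' := uIoc_subset_uIcc hs
  rw [mem_uIcc] at hs'
  have h1 := le_max_left |a| |b|
  have h2 := le_max_right |a| |b|
  have := neg_abs_le a
  have := neg_abs_le b
  have := le_abs_self a
  have := le_abs_self b
  constructor <;> rcases hs' with h | h <;> linarith [h.1, h.2]

theorem continuous_primitive [NormedSpace ℝ F] {f : ℝ → F}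
    (hf : LocallyBoundedMeasurable f) (a : ℝ) : Continuous fun t => ∫ s in a..t, f s :=
  intervalIntegral.continuous_primitive hf.intervalIntegrable a

theorem locallyIntegrable {f : ℝ → F} (hf : LocallyBoundedMeasurable f) :
    LocallyIntegrable f volume := by
  intro t
  refine ⟨Icc (t - 1) (t + 1), Icc_mem_nhds (by linarith) (by linarith), ?_⟩
  exact (intervalIntegrable_iff_integrableOn_Icc_of_le (by linarith)).1
    (hf.intervalIntegrable _ _)

/-- A function that differs from a primitive of a locally bounded function by a constant is
absolutely continuous. -/
theorem absolutelyContinuousOnInterval [NormedSpace ℝ F] {f x : ℝ → F}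
    (hf : LocallyBoundedMeasurable f) {c : F} {a T : ℝ}
    (hx : ∀ t ∈ uIcc 0 T, x t = c + ∫ s in a..t, f s) :
    AbsolutelyContinuousOnInterval x 0 T := by
  obtain ⟨C, hC⟩ := hf.2 |T|
  -- A bound `C` on the integrand makes the primitive `C`-Lipschitz.
  refine LipschitzOnWith.absolutelyContinuousOnInterval (K := C.toNNReal)
    (LipschitzOnWith.of_dist_le_mul fun t ht r hr => ?_)
  rw [hx t ht, hx r hr, dist_add_left, dist_eq_norm, intervalIntegral.integral_interval_sub_left (hf.intervalIntegrable _ _)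
    (hf.intervalIntegrable _ _), Real.dist_eq]
  refine intervalIntegral.norm_integral_le_of_norm_le_const fun s hs => ?_
  have hs' : s ∈ uIcc 0 T := uIcc_subset_uIcc hr ht (uIoc_subset_uIcc hs)
  refine (hC s ?_).trans (Real.le_coe_toNNReal C)
  rw [mem_uIcc] at hs'
  have := neg_abs_le T
  have := le_abs_self T
  have := abs_nonneg T
  constructor <;> rcases hs' with h | h <;> linarith [h.1, h.2]

end LocallyBoundedMeasurable

/-! ### Linear Volterra equations and Grönwall estimates -/

section Volterra

variable {E : Type*} [NormedAddCommGroup E] [NormedSpace ℝ E]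

/-- The terms of the Neumann series of the equation `x = g + ∫ a x`. -/
noncomputable def neumannTerm (a : ℝ → E →L[ℝ] E) (g : ℝ → E) : ℕ → ℝ → E
  | 0 => g
  | n + 1 => fun t => ∫ s in (0 : ℝ)..t, a s (neumannTerm a g n s)

variable {a : ℝ → E →L[ℝ] E} {g : ℝ → E}

theorem continuous_neumannTerm (ha : LocallyBoundedMeasurable a) (hg : Continuous g) (n : ℕ) :
    Continuous (neumannTerm a g n) := by
  induction n with
  | zero => exact hg
  | succ n ih => exact (ha.clm_apply (.of_continuous ih)).continuous_primitive 0

/-- Each iteration multiplies by at most `M` and integrates a power of `t`, which builds up the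
factorial and makes the series converge uniformly on bounded intervals. -/
theorem norm_neumannTerm_le {T M K : ℝ} (hM : ∀ s ∈ Icc 0 T, ‖a s‖ ≤ M)
    (hK : ∀ s ∈ Icc 0 T, ‖g s‖ ≤ K) (n : ℕ) {t : ℝ} (ht : t ∈ Icc 0 T) :
    ‖neumannTerm a g n t‖ ≤ K * ((M * t) ^ n / n.factorial) := by
  induction n generalizing t with
  | zero => simpa [neumannTerm] using hK t ht
  | succ n ih =>
    have hint : ∫ s in (0 : ℝ)..t, M * (K * ((M * s) ^ n / n.factorial)) =
        K * ((M * t) ^ (n + 1) / (n + 1).factorial) := by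
      have : ∀ s : ℝ, M * (K * ((M * s) ^ n / n.factorial)) =
          M * K * M ^ n / n.factorial * s ^ n := fun s => by ring
      simp only [this, intervalIntegral.integral_const_mul, integral_pow, Nat.factorial_succ]
      push_cast
      field_simp
      ring
    rw [← hint]
    refine intervalIntegral.norm_integral_le_of_norm_le ht.1 (ae_of_all _ fun s hs => ?_)
      (Continuous.intervalIntegrable (by fun_prop) _ _)
    have hs' : s ∈ Icc 0 T := ⟨hs.1.le, hs.2.trans ht.2⟩
    exact (a s).le_of_opNorm_le_of_le (hM s hs') (ih hs')

/-- The linear Volterra equation `x(t) = g(t) + ∫₀ᵗ a(s) x(s) ds` has a continuous solution. -/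
theorem exists_volterra_solution [CompleteSpace E] (ha : LocallyBoundedMeasurable a)
    (hg : Continuous g) :
    ∃ x : ℝ → E, Continuous x ∧ ∀ t, 0 ≤ t → x t = g t + ∫ s in (0 : ℝ)..t, a s (x s) := by
  let X : ℝ → E := fun t => ∑' n, neumannTerm a g n t
  have hbound : ∀ T : ℝ, ∃ M K : ℝ, (∀ s ∈ Icc 0 T, ‖a s‖ ≤ M) ∧ 0 ≤ M ∧ 0 ≤ K ∧
      ∀ n, ∀ t ∈ Icc 0 T, ‖neumannTerm a g n t‖ ≤ K * ((M * T) ^ n / n.factorial) := by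
    intro T
    obtain ⟨M, hM⟩ := ha.2 T
    obtain ⟨K, hK⟩ := isCompact_Icc.exists_bound_of_continuousOn (s := Icc 0 T) hg.continuousOn
    have hM' : ∀ s ∈ Icc 0 T, ‖a s‖ ≤ max M 0 := fun s hs =>
      (hM s ⟨by linarith [hs.1, hs.2], hs.2⟩).trans (le_max_left _ _)
    have hK' : ∀ s ∈ Icc 0 T, ‖g s‖ ≤ max K 0 := fun s hs => (hK s hs).trans (le_max_left _ _)
    refine ⟨max M 0, max K 0, hM', le_max_right _ _, le_max_right _ _, fun n t ht => ?_⟩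
    refine (norm_neumannTerm_le hM' hK' n ht).trans ?_
    have := ht.1
    have := ht.2
    gcongr
  have hsum : ∀ M K T : ℝ, Summable fun n : ℕ => K * ((M * T) ^ n / n.factorial) :=
    fun M K T => (Real.summable_pow_div_factorial (M * T)).mul_left K
  have hXsum : ∀ t, 0 ≤ t → HasSum (fun n => neumannTerm a g n t) (X t) := by
    intro t ht
    obtain ⟨M, K, -, -, -, h⟩ := hbound t
    exact (Summable.of_norm_bounded (hsum M K t) fun n => h n t ⟨ht, le_rfl⟩).hasSum
  have hXcont : ContinuousOn X (Ici 0) := by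
    intro t ht
    obtain ⟨M, K, -, -, -, h⟩ := hbound (t + 1)
    have : ContinuousOn X (Icc 0 (t + 1)) := continuousOn_tsum
      (fun n => (continuous_neumannTerm ha hg n).continuousOn) (hsum M K (t + 1)) h
    refine (this t ⟨ht, by linarith⟩).mono_of_mem_nhdsWithin ?_
    filter_upwards [self_mem_nhdsWithin,
      mem_nhdsWithin_of_mem_nhds (Iio_mem_nhds (lt_add_one t))] with s hs hs'
    exact ⟨hs, le_of_lt hs'⟩
  -- The series is controlled only for `t ≥ 0`; freezing it at its value at `0` gives continuity on
  -- the whole line.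
  refine ⟨fun t => X (max t 0), hXcont.comp_continuous (by fun_prop) fun t => mem_Ici.2 (le_max_right t 0),
    fun t ht => ?_⟩
  have hcongr : ∫ s in (0 : ℝ)..t, a s (X (max s 0)) = ∫ s in (0 : ℝ)..t, a s (X s) :=
    intervalIntegral.integral_congr fun s hs => by
      rw [uIcc_of_le ht] at hs
      simp only [max_eq_left hs.1]
  simp only [hcongr, max_eq_left ht]
  obtain ⟨M, K, hM, hM0, -, h⟩ := hbound t
  -- Dominated convergence integrates the series termwise; this shifts the index by one, and the
  -- missing term is `g`.
  have hI : HasSum (fun n => neumannTerm a g (n + 1) t) (∫ s in (0 : ℝ)..t, a s (X s)) := by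
    refine intervalIntegral.hasSum_integral_of_dominated_convergence
      (fun n _ => M * (K * ((M * t) ^ n / n.factorial))) (fun n => ?_)
      (fun n => ae_of_all _ fun s hs => ?_)
      (ae_of_all _ fun _ _ => (hsum M K t).mul_left M) intervalIntegrable_const
      (ae_of_all _ fun s hs => ?_)
    · exact ((ha.clm_apply (.of_continuous (continuous_neumannTerm ha hg n))).1).restrict
    · rw [uIoc_of_le ht] at hs
      have hs' : s ∈ Icc 0 t := ⟨hs.1.le, hs.2⟩
      exact (a s).le_of_opNorm_le_of_le (hM s hs') (h n s hs')
    · rw [uIoc_of_le ht] at hs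
      exact (a s).hasSum (hXsum s hs.1.le)
  refine (hXsum t ht).unique ?_
  simpa [neumannTerm, add_comm] using (hasSum_nat_add_iff (f := fun n => neumannTerm a g n t) 1).1 hI

/-- A nonnegative function that is dominated by a multiple of its primitive vanishes. -/
theorem eq_zero_of_le_mul_integral {f : ℝ → ℝ} (hf : Continuous f) (hf0 : ∀ t, 0 ≤ f t) {M T : ℝ}
    (h : ∀ t ∈ Icc 0 T, f t ≤ M * ∫ s in (0 : ℝ)..t, f s) : ∀ t ∈ Icc 0 T, f t = 0 := by
  -- The primitive starts at zero and its derivative is at most `M` times itself, so Grönwall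
  -- applies.
  have hg : ∀ t ∈ Icc 0 T, ∫ s in (0 : ℝ)..t, f s = 0 := by
    refine eq_zero_of_abs_deriv_le_mul_abs_self_of_eq_zero_right (f' := f) (K := M)
      (intervalIntegral.continuous_primitive (fun _ _ => hf.intervalIntegrable _ _) 0).continuousOn
      (fun t _ => (hf.integral_hasStrictDerivAt 0 t).hasDerivAt.hasDerivWithinAt) (by simp)
      fun t ht => ?_
    rw [Real.norm_of_nonneg (hf0 t), Real.norm_of_nonneg
      (intervalIntegral.integral_nonneg ht.1 fun s _ => hf0 s)]
    exact h t ⟨ht.1, ht.2.le⟩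
  intro t ht
  refine le_antisymm ?_ (hf0 t)
  simpa [hg t ht] using h t ht

/-- The backward version of `eq_zero_of_le_mul_integral`. -/
theorem eq_zero_of_le_mul_integral_right {f : ℝ → ℝ} (hf : Continuous f) (hf0 : ∀ t, 0 ≤ f t)
    {M T : ℝ} (h : ∀ t ∈ Icc 0 T, f t ≤ M * ∫ s in t..T, f s) : ∀ t ∈ Icc 0 T, f t = 0 := by
  intro t ht
  have := eq_zero_of_le_mul_integral (f := fun s => f (T - s)) (M := M) (T := T) (by fun_prop)
    (fun s => hf0 _) (fun s hs => by
      simpa [intervalIntegral.integral_comp_sub_left] using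
        h (T - s) ⟨by linarith [hs.2], by linarith [hs.1]⟩) (T - t)
    ⟨by linarith [ht.2], by linarith [ht.1]⟩
  simpa using this

end Volterra

/-! ### Piecewise continuous functions and concatenation -/

/-- `CT.PiecewiseContinuous` for functions with values in an arbitrary space. -/
def PiecewiseContinuousMap {F : Type*} [TopologicalSpace F] (f : ℝ≥0 → F) : Prop :=
  (∀ T : ℝ≥0, {t : ℝ≥0 | t ≤ T ∧ ¬ ContinuousAt f t}.Finite) ∧
  ∀ t : ℝ≥0, (∃ l, Tendsto f (𝓝[<] t) (𝓝 l)) ∧ (∃ l, Tendsto f (𝓝[>] t) (𝓝 l))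

/-- The function `f` before time `T`, followed by the function `g`. -/
noncomputable def concatAt {F : Type*} (T : ℝ≥0) (f g : ℝ≥0 → F) (t : ℝ≥0) : F :=
  if t < T then f t else g (t - T)

theorem concatAt_of_lt {F : Type*} {T : ℝ≥0} (f g : ℝ≥0 → F) {t : ℝ≥0} (h : t < T) :
    concatAt T f g t = f t := if_pos h

theorem concatAt_of_le {F : Type*} {T : ℝ≥0} (f g : ℝ≥0 → F) {t : ℝ≥0} (h : T ≤ t) :
    concatAt T f g t = g (t - T) := if_neg h.not_gt

theorem concatAt_add {F : Type*} (T : ℝ≥0) (f g : ℝ≥0 → F) (t : ℝ≥0) :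
    concatAt T f g (T + t) = g t := by
  simp [concatAt]

theorem concatAt_self_const {F : Type*} (T : ℝ≥0) (c : F) :
    concatAt T (fun _ => c) (fun _ => c) = fun _ => c := by
  funext t
  simp [concatAt]

namespace PiecewiseContinuousMap

variable {F G : Type*}

section Topology

variable [TopologicalSpace F] [TopologicalSpace G]

theorem of_continuous {f : ℝ≥0 → F} (hf : Continuous f) : PiecewiseContinuousMap f :=
  ⟨fun _ => by simp [hf.continuousAt], fun t =>
    ⟨⟨f t, hf.continuousAt.mono_left nhdsWithin_le_nhds⟩,
      ⟨f t, hf.continuousAt.mono_left nhdsWithin_le_nhds⟩⟩⟩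

theorem comp {f : ℝ≥0 → F} (hf : PiecewiseContinuousMap f) {g : F → G} (hg : Continuous g) :
    PiecewiseContinuousMap fun t => g (f t) := by
  refine ⟨fun T => (hf.1 T).subset fun t ht => ⟨ht.1, fun h => ht.2 ?_⟩, fun t => ⟨?_, ?_⟩⟩
  · exact hg.continuousAt.comp h
  · exact (hf.2 t).1.imp' g fun l h => (hg.tendsto l).comp h
  · exact (hf.2 t).2.imp' g fun l h => (hg.tendsto l).comp h

theorem prodMk {f : ℝ≥0 → F} {g : ℝ≥0 → G} (hf : PiecewiseContinuousMap f)
    (hg : PiecewiseContinuousMap g) : PiecewiseContinuousMap fun t => (f t, g t) := by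
  refine ⟨fun T => ((hf.1 T).union (hg.1 T)).subset fun t ht => ?_, fun t => ⟨?_, ?_⟩⟩
  · by_contra h
    simp only [mem_union, mem_ofPred_eq, not_or, not_and, not_not] at h
    exact ht.2 ((h.1 ht.1).prodMk (h.2 ht.1))
  · obtain ⟨l, hl⟩ := (hf.2 t).1
    obtain ⟨m, hm⟩ := (hg.2 t).1
    exact ⟨(l, m), hl.prodMk_nhds hm⟩
  · obtain ⟨l, hl⟩ := (hf.2 t).2
    obtain ⟨m, hm⟩ := (hg.2 t).2
    exact ⟨(l, m), hl.prodMk_nhds hm⟩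

/-- Near any time other than `T` the concatenation coincides with `f` or with a translate of `g`, so
`T` is the only possible new discontinuity. -/
theorem concatAt {f g : ℝ≥0 → F} (hf : PiecewiseContinuousMap f)
    (hg : PiecewiseContinuousMap g) (T : ℝ≥0) : PiecewiseContinuousMap (concatAt T f g) := by
  have hlt : ∀ t < T, _root_.concatAt T f g =ᶠ[𝓝 t] f := fun t ht => by
    filter_upwards [Iio_mem_nhds ht] with s hs
    exact concatAt_of_lt f g hs
  have hgt : ∀ t, T < t → _root_.concatAt T f g =ᶠ[𝓝 t] fun s => g (s - T) := fun t ht => by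
    filter_upwards [Ioi_mem_nhds ht] with s hs
    exact concatAt_of_le f g (le_of_lt hs)
  have hsub : Continuous fun s : ℝ≥0 => s - T := by fun_prop
  refine ⟨fun R => ?_, fun t => ⟨?_, ?_⟩⟩
  · refine (((hf.1 R).union (finite_singleton T)).union
      ((hg.1 R).image fun s => s + T)).subset fun t ht => ?_
    rcases lt_trichotomy t T with h | rfl | h
    · exact Or.inl (Or.inl ⟨ht.1, fun hc => ht.2 (hc.congr (hlt t h).symm)⟩)
    · exact Or.inl (Or.inr rfl)
    · refine Or.inr ⟨t - T, ⟨tsub_le_self.trans ht.1, fun hc => ht.2 ?_⟩,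
        tsub_add_cancel_of_le h.le⟩
      exact (ContinuousAt.comp (f := fun s : ℝ≥0 => s - T) hc hsub.continuousAt).congr
        (hgt t h).symm
  · rcases lt_trichotomy t T with h | rfl | h
    · obtain ⟨l, hl⟩ := (hf.2 t).1
      exact ⟨l, hl.congr' ((hlt t h).symm.filter_mono nhdsWithin_le_nhds)⟩
    · obtain ⟨l, hl⟩ := (hf.2 t).1
      refine ⟨l, hl.congr' ?_⟩
      filter_upwards [self_mem_nhdsWithin] with s hs
      exact (concatAt_of_lt f g hs).symm
    · obtain ⟨l, hl⟩ := (hg.2 (t - T)).1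
      refine ⟨l, Tendsto.congr' ((hgt t h).symm.filter_mono nhdsWithin_le_nhds) (hl.comp ?_)⟩
      refine tendsto_nhdsWithin_iff.2 ⟨(hsub.tendsto t).mono_left nhdsWithin_le_nhds, ?_⟩
      filter_upwards [self_mem_nhdsWithin, nhdsWithin_le_nhds (Ioi_mem_nhds h)] with s hs hs'
      exact tsub_lt_tsub_right_of_le (le_of_lt (mem_Ioi.1 hs')) (mem_Iio.1 hs)
  · rcases lt_or_ge t T with h | h
    · obtain ⟨l, hl⟩ := (hf.2 t).2
      exact ⟨l, hl.congr' ((hlt t h).symm.filter_mono nhdsWithin_le_nhds)⟩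
    · obtain ⟨l, hl⟩ := (hg.2 (t - T)).2
      have heq : (fun s => g (s - T)) =ᶠ[𝓝[>] t] _root_.concatAt T f g := by
        filter_upwards [self_mem_nhdsWithin] with s hs
        exact (concatAt_of_le f g (h.trans (le_of_lt hs))).symm
      refine ⟨l, Tendsto.congr' heq (hl.comp ?_)⟩
      refine tendsto_nhdsWithin_iff.2 ⟨(hsub.tendsto t).mono_left nhdsWithin_le_nhds, ?_⟩
      filter_upwards [self_mem_nhdsWithin] with s hs
      exact tsub_lt_tsub_right_of_le h hs

theorem countable_not_continuousAt {f : ℝ≥0 → F} (hf : PiecewiseContinuousMap f) :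
    {t | ¬ ContinuousAt f t}.Countable := by
  refine (countable_iUnion fun n : ℕ => (hf.1 n).countable).mono fun t ht => ?_
  obtain ⟨n, hn⟩ := exists_nat_ge t
  exact mem_iUnion.2 ⟨n, hn, ht⟩

end Topology

variable [NormedAddCommGroup F]

/-- Near each point `f` is bounded by means of its value and its two one-sided limits; compactness
makes the bound uniform. -/
theorem exists_bound {f : ℝ≥0 → F} (hf : PiecewiseContinuousMap f) (T : ℝ≥0) :
    ∃ C, ∀ t ∈ Icc 0 T, ‖f t‖ ≤ C := by
  refine isCompact_Icc.induction_on (p := fun s => ∃ C, ∀ t ∈ s, ‖f t‖ ≤ C) ⟨0, by simp⟩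
    (fun s s' h ⟨C, hC⟩ => ⟨C, fun t ht => hC t (h ht)⟩) ?_ fun t _ => ?_
  · rintro s s' ⟨C, hC⟩ ⟨D, hD⟩
    refine ⟨max C D, fun t ht => ?_⟩
    rcases ht with ht | ht
    · exact (hC t ht).trans (le_max_left _ _)
    · exact (hD t ht).trans (le_max_right _ _)
  · obtain ⟨l, hl⟩ := (hf.2 t).1
    obtain ⟨m, hm⟩ := (hf.2 t).2
    let C := max ‖f t‖ (max (‖l‖ + 1) (‖m‖ + 1))
    have h : ∀ᶠ s in 𝓝 t, ‖f s‖ ≤ C := by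
      rw [← pure_sup_nhdsNE, ← Iio_union_Ioi, nhdsWithin_union, eventually_sup, eventually_sup]
      refine ⟨by simp [C], ?_, ?_⟩
      · filter_upwards [hl.norm.eventually_le_const (lt_add_one _)] with s hs
        exact hs.trans ((le_max_left _ _).trans (le_max_right _ _))
      · filter_upwards [hm.norm.eventually_le_const (lt_add_one _)] with s hs
        exact hs.trans ((le_max_right _ _).trans (le_max_right _ _))
    exact ⟨{s | ‖f s‖ ≤ C}, nhdsWithin_le_nhds h, C, fun s hs => hs⟩

/-- The extension of a piecewise continuous function to the line. -/
theorem locallyBoundedMeasurable {f : ℝ≥0 → F} (hf : PiecewiseContinuousMap f) :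
    LocallyBoundedMeasurable fun s : ℝ => f s.toNNReal := by
  refine ⟨?_, fun T => ?_⟩
  -- Off this countable, hence null, set the extension is continuous. The point `0`, where the
  -- constant left part is attached, is included to avoid a separate check.
  · let D : Set ℝ := {s | ¬ ContinuousAt f s.toNNReal ∧ 0 < s} ∪ {0}
    have hD : D.Countable := by
      refine Countable.union ?_ (countable_singleton 0)
      refine (hf.countable_not_continuousAt.image fun t : ℝ≥0 => (t : ℝ)).mono ?_
      rintro s ⟨h, hs⟩
      exact ⟨s.toNNReal, h, Real.coe_toNNReal s hs.le⟩
    have hc : ContinuousOn (fun s : ℝ => f s.toNNReal) Dᶜ := by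
      intro s hs
      refine ContinuousAt.continuousWithinAt ?_
      simp only [D, mem_compl_iff, mem_union, mem_ofPred_eq, mem_singleton_iff, not_or, not_and,
        not_lt] at hs
      rcases lt_or_gt_of_ne hs.2 with h | h
      · have heq : (fun s : ℝ => f s.toNNReal) =ᶠ[𝓝 s] fun _ => f 0 := by
          filter_upwards [Iio_mem_nhds h] with r hr
          rw [Real.toNNReal_of_nonpos (le_of_lt hr)]
        exact continuousAt_const.congr heq.symm
      · have : ContinuousAt f s.toNNReal := by
          by_contra h'
          exact absurd h (hs.1 h').not_gt
        exact ContinuousAt.comp (f := Real.toNNReal) this continuous_real_toNNReal.continuousAt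
    have := hc.aestronglyMeasurable (μ := volume) hD.measurableSet.compl
    rwa [Measure.restrict_eq_self_of_ae_mem] at this
    exact compl_mem_ae_iff.2 (hD.measure_zero volume)
  · obtain ⟨C, hC⟩ := hf.exists_bound T.toNNReal
    exact ⟨C, fun s hs => hC _ ⟨zero_le, Real.toNNReal_le_toNNReal hs.2⟩⟩

end PiecewiseContinuousMap

/-! ### Continuity of the system maps -/

namespace LPVSSA

variable {np : ℕ} {P : Set (Fin np → ℝ)} {nx nu ny : ℕ}

theorem continuous_affineMatrix {np m n : ℕ} (M : Fin (np + 1) → Matrix (Fin m) (Fin n) ℝ) :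
    Continuous (affineMatrix M) := by
  unfold affineMatrix
  fun_prop

theorem continuous_outputMap (S : LPVSSA P nx nu ny) :
    Continuous fun w : (Fin np → ℝ) × (Fin nx → ℝ) × (Fin nu → ℝ) =>
      S.outputMap w.1 w.2.1 w.2.2 := by
  have hC := continuous_affineMatrix S.C
  have hD := continuous_affineMatrix S.D
  unfold outputMap
  fun_prop

theorem continuous_stateMap (S : LPVSSA P nx nu ny) :
    Continuous fun w : (Fin np → ℝ) × (Fin nx → ℝ) × (Fin nu → ℝ) =>
      S.stateMap w.1 w.2.1 w.2.2 := by
  have hA := continuous_affineMatrix S.A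
  have hB := continuous_affineMatrix S.B
  unfold stateMap
  fun_prop

/-- The state matrix as a continuous linear map. -/
noncomputable def stateCLM (S : LPVSSA P nx nu ny) (p : Fin np → ℝ) :
    (Fin nx → ℝ) →L[ℝ] (Fin nx → ℝ) :=
  (Matrix.toLin'.trans LinearMap.toContinuousLinearMap) (affineMatrix S.A p)

theorem continuous_stateCLM (S : LPVSSA P nx nu ny) : Continuous S.stateCLM :=
  (LinearMap.continuous_of_finiteDimensional
    (Matrix.toLin'.trans LinearMap.toContinuousLinearMap :
      Matrix (Fin nx) (Fin nx) ℝ ≃ₗ[ℝ] _).toLinearMap).comp (continuous_affineMatrix S.A)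

theorem stateMap_eq_stateCLM_add (S : LPVSSA P nx nu ny) (p : Fin np → ℝ) (x : Fin nx → ℝ)
    (u : Fin nu → ℝ) : S.stateMap p x u = S.stateCLM p x + S.stateMap p 0 u := by
  simp [stateMap, stateCLM]

theorem stateMap_sub_stateMap (S : LPVSSA P nx nu ny) (p : Fin np → ℝ) (x y : Fin nx → ℝ)
    (u : Fin nu → ℝ) : S.stateMap p x u - S.stateMap p y u = S.stateCLM p (x - y) := by
  rw [stateMap_eq_stateCLM_add, stateMap_eq_stateCLM_add S p y, map_sub]
  abel

end LPVSSA

/-! ### Continuous time: mild solutions -/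

namespace CT

variable {np : ℕ} {P : Set (Fin np → ℝ)} {nx nx' nu ny : ℕ}

/-- The integrated form of the state equation, with initial state `x₀`. -/
def IsMildSolution (S : LPVSSA P nx nu ny) (u : Signal nu) (p : Scheduling P) (x₀ : Fin nx → ℝ)
    (x : ℝ≥0 → Fin nx → ℝ) : Prop :=
  Continuous x ∧ ∀ t : ℝ≥0, x t = x₀ + ∫ s in (0 : ℝ)..t,
    S.stateMap (p.1 s.toNNReal) (x s.toNNReal) (u.1 s.toNNReal)

/-- Piecewise continuity of the triple passes to the right-hand sides of both equations, since these
are continuous in all arguments jointly. -/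
theorem piecewiseContinuousMap_triple (u : Signal nu) (p : Scheduling P)
    {x : ℝ≥0 → Fin nx → ℝ} (hx : Continuous x) :
    PiecewiseContinuousMap fun t => (p.1 t, x t, u.1 t) :=
  PiecewiseContinuousMap.prodMk p.2.1
    (PiecewiseContinuousMap.prodMk (.of_continuous hx) u.2)

theorem locallyBoundedMeasurable_stateMap (S : LPVSSA P nx nu ny) (u : Signal nu)
    (p : Scheduling P) {x : ℝ≥0 → Fin nx → ℝ} (hx : Continuous x) :
    LocallyBoundedMeasurable fun s : ℝ =>
      S.stateMap (p.1 s.toNNReal) (x s.toNNReal) (u.1 s.toNNReal) :=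
  ((piecewiseContinuousMap_triple u p hx).comp S.continuous_stateMap).locallyBoundedMeasurable

theorem locallyBoundedMeasurable_stateCLM (S : LPVSSA P nx nu ny) (p : Scheduling P) :
    LocallyBoundedMeasurable fun s : ℝ => S.stateCLM (p.1 s.toNNReal) :=
  (PiecewiseContinuousMap.comp p.2.1 S.continuous_stateCLM).locallyBoundedMeasurable

/-- This is the Volterra equation with kernel `A(p)`; the constant `x₀` and the integral of `B(p) u`
form the inhomogeneity. -/
theorem exists_isMildSolution (S : LPVSSA P nx nu ny) (u : Signal nu) (p : Scheduling P)
    (x₀ : Fin nx → ℝ) : ∃ x, IsMildSolution S u p x₀ x := by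
  have ha := locallyBoundedMeasurable_stateCLM S p
  have hb := locallyBoundedMeasurable_stateMap S u p (x := fun _ => 0) continuous_const
  obtain ⟨x, hx, h⟩ := exists_volterra_solution ha
    ((hb.continuous_primitive 0).const_add x₀)
  refine ⟨fun t => x t, hx.comp NNReal.continuous_coe, fun t => ?_⟩
  simp only
  rw [h t t.2, add_assoc, ← intervalIntegral.integral_add (hb.intervalIntegrable _ _)
    ((ha.clm_apply (.of_continuous hx)).intervalIntegrable _ _)]
  congr 1
  refine intervalIntegral.integral_congr fun s hs => ?_
  rw [uIcc_of_le t.coe_nonneg] at hs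
  simp only [Real.coe_toNNReal s hs.1]
  rw [S.stateMap_eq_stateCLM_add _ (x s), add_comm]

theorem exists_norm_stateCLM_le (S : LPVSSA P nx nu ny) (p : Scheduling P) (T : ℝ) :
    ∃ M, ∀ s ∈ Icc 0 T, ‖S.stateCLM (p.1 s.toNNReal)‖ ≤ M := by
  obtain ⟨M, hM⟩ := (locallyBoundedMeasurable_stateCLM S p).2 T
  exact ⟨M, fun s hs => hM s ⟨by linarith [hs.1, hs.2], hs.2⟩⟩

/-- Mild solutions with the same initial state and signals that agree before time `T` agree up to
time `T`. -/
theorem IsMildSolution.eq_of_le {S : LPVSSA P nx nu ny} {u v : Signal nu} {p q : Scheduling P}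
    {x₀ : Fin nx → ℝ} {x y : ℝ≥0 → Fin nx → ℝ} (hx : IsMildSolution S u p x₀ x)
    (hy : IsMildSolution S v q x₀ y) {T : ℝ≥0} (hu : ∀ t < T, u.1 t = v.1 t)
    (hp : ∀ t < T, p.1 t = q.1 t) {t : ℝ≥0} (ht : t ≤ T) : x t = y t := by
  obtain ⟨M, hM⟩ := exists_norm_stateCLM_le S p T
  have hcont : Continuous fun s : ℝ => ‖x s.toNNReal - y s.toNNReal‖ :=
    ((hx.1.comp continuous_real_toNNReal).sub (hy.1.comp continuous_real_toNNReal)).norm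
  have key := eq_zero_of_le_mul_integral hcont (fun _ => norm_nonneg _) (M := M) (T := T)
    fun s hs => ?_
  · simpa [sub_eq_zero] using key t ⟨t.2, NNReal.coe_le_coe.2 ht⟩
  rw [hx.2, hy.2, Real.coe_toNNReal s hs.1, add_sub_add_left_eq_sub,
    ← intervalIntegral.integral_sub
      ((locallyBoundedMeasurable_stateMap S u p hx.1).intervalIntegrable _ _)
      ((locallyBoundedMeasurable_stateMap S v q hy.1).intervalIntegrable _ _),
    ← intervalIntegral.integral_const_mul]
  refine intervalIntegral.norm_integral_le_of_norm_le hs.1 ?_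
    ((hcont.const_mul M).intervalIntegrable _ _)
  -- The signals agree only strictly before `T`; the endpoint is a null set.
  filter_upwards [compl_mem_ae_iff.2 (measure_singleton (T : ℝ))] with r hrT hr
  have hr' : r.toNNReal < T := by
    rw [← NNReal.coe_lt_coe, Real.coe_toNNReal r hr.1.le]
    exact lt_of_le_of_ne (hr.2.trans hs.2) hrT
  rw [hu _ hr', hp _ hr', S.stateMap_sub_stateMap, ← hp _ hr']
  exact (S.stateCLM _).le_of_opNorm_le (hM r ⟨hr.1.le, hr.2.trans hs.2⟩) _

theorem IsMildSolution.unique {S : LPVSSA P nx nu ny} {u : Signal nu} {p : Scheduling P}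
    {x₀ : Fin nx → ℝ} {x y : ℝ≥0 → Fin nx → ℝ} (hx : IsMildSolution S u p x₀ x)
    (hy : IsMildSolution S u p x₀ y) : x = y :=
  funext fun _ => hx.eq_of_le hy (fun _ _ => rfl) (fun _ _ => rfl) le_rfl

theorem IsMildSolution.integral_eq_sub {S : LPVSSA P nx nu ny} {u : Signal nu}
    {p : Scheduling P} {x₀ : Fin nx → ℝ} {x : ℝ≥0 → Fin nx → ℝ} (hx : IsMildSolution S u p x₀ x)
    (r t : ℝ≥0) :
    ∫ s in (r : ℝ)..t, S.stateMap (p.1 s.toNNReal) (x s.toNNReal) (u.1 s.toNNReal) =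
      x t - x r := by
  have hI := locallyBoundedMeasurable_stateMap S u p hx.1
  rw [hx.2 t, hx.2 r, add_sub_add_left_eq_sub, intervalIntegral.integral_interval_sub_left
    (hI.intervalIntegrable _ _) (hI.intervalIntegrable _ _)]

theorem IsMildSolution.initial {S : LPVSSA P nx nu ny} {u : Signal nu} {p : Scheduling P}
    {x₀ : Fin nx → ℝ} {x : ℝ≥0 → Fin nx → ℝ} (hx : IsMildSolution S u p x₀ x) : x 0 = x₀ := by
  simpa using hx.2 0

/-- Backward uniqueness: the initial state is determined by a later state. -/
theorem IsMildSolution.initial_eq {S : LPVSSA P nx nu ny} {u : Signal nu} {p : Scheduling P}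
    {x₀ y₀ : Fin nx → ℝ} {x y : ℝ≥0 → Fin nx → ℝ} (hx : IsMildSolution S u p x₀ x)
    (hy : IsMildSolution S u p y₀ y) {T : ℝ≥0} (h : x T = y T) : x₀ = y₀ := by
  obtain ⟨M, hM⟩ := exists_norm_stateCLM_le S p T
  have hcont : Continuous fun s : ℝ => ‖x s.toNNReal - y s.toNNReal‖ :=
    ((hx.1.comp continuous_real_toNNReal).sub (hy.1.comp continuous_real_toNNReal)).norm
  have key := eq_zero_of_le_mul_integral_right hcont (fun _ => norm_nonneg _) (M := M) (T := T)
    fun s hs => ?_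
  · have := key 0 ⟨le_rfl, T.2⟩
    rw [← hx.initial, ← hy.initial]
    simpa [sub_eq_zero] using this
  -- As the states coincide at `T`, their difference at `s` is minus an integral over `[s, T]`, so
  -- Grönwall runs backwards from `T`.
  have hxy : x s.toNNReal - y s.toNNReal = -((x T - x s.toNNReal) - (y T - y s.toNNReal)) := by
    rw [h]
    abel
  rw [hxy, norm_neg, ← hx.integral_eq_sub, ← hy.integral_eq_sub, Real.coe_toNNReal s hs.1,
    ← intervalIntegral.integral_sub
      ((locallyBoundedMeasurable_stateMap S u p hx.1).intervalIntegrable _ _)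
      ((locallyBoundedMeasurable_stateMap S u p hy.1).intervalIntegrable _ _),
    ← intervalIntegral.integral_const_mul]
  refine intervalIntegral.norm_integral_le_of_norm_le hs.2 (ae_of_all _ fun r hr => ?_)
    ((hcont.const_mul M).intervalIntegrable _ _)
  rw [S.stateMap_sub_stateMap]
  exact (S.stateCLM _).le_of_opNorm_le (hM r ⟨hs.1.trans hr.1.le, hr.2⟩) _

theorem IsMildSolution.add_smul {S : LPVSSA P nx nu ny} {u v w : Signal nu} {p : Scheduling P}
    {x₀ y₀ : Fin nx → ℝ} {x y : ℝ≥0 → Fin nx → ℝ} {c : ℝ} (hx : IsMildSolution S u p x₀ x)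
    (hy : IsMildSolution S v p y₀ y) (hw : w.1 = u.1 + c • v.1) :
    IsMildSolution S w p (x₀ + c • y₀) (x + c • y) := by
  refine ⟨hx.1.add (hy.1.const_smul c), fun t => ?_⟩
  have hI := intervalIntegral.integral_add
    ((locallyBoundedMeasurable_stateMap S u p hx.1).intervalIntegrable 0 t)
    (((locallyBoundedMeasurable_stateMap S v p hy.1).intervalIntegrable 0 t).smul c)
  simp only [Pi.smul_apply, intervalIntegral.integral_smul] at hI
  simp only [hw, Pi.add_apply, Pi.smul_apply, S.stateMap_add_smul]
  rw [hI, hx.2 t, hy.2 t, smul_add]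
  abel

theorem IsMildSolution.shift {S : LPVSSA P nx nu ny} {u v : Signal nu} {p q : Scheduling P}
    {x₀ : Fin nx → ℝ} {x : ℝ≥0 → Fin nx → ℝ} (hx : IsMildSolution S u p x₀ x) {T : ℝ≥0}
    (hu : ∀ t, u.1 (T + t) = v.1 t) (hp : ∀ t, p.1 (T + t) = q.1 t) :
    IsMildSolution S v q (x T) fun t => x (T + t) := by
  refine ⟨hx.1.comp (continuous_const_add T), fun t => ?_⟩
  have hI := hx.integral_eq_sub T (T + t)
  rw [eq_sub_iff_add_eq'] at hI
  refine hI.symm.trans (congrArg (x T + ·) ?_)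
  have hsub := intervalIntegral.integral_comp_add_left (a := 0) (b := (t : ℝ))
    (fun s : ℝ => S.stateMap (p.1 s.toNNReal) (x s.toNNReal) (u.1 s.toNNReal)) (T : ℝ)
  rw [add_zero] at hsub
  rw [NNReal.coe_add, ← hsub]
  refine intervalIntegral.integral_congr fun s hs => ?_
  rw [uIcc_of_le t.coe_nonneg] at hs
  simp only [Real.toNNReal_add T.coe_nonneg hs.1, Real.toNNReal_coe, hu, hp]

/-- The state trajectory started at `x₀`. -/
noncomputable def traj (S : LPVSSA P nx nu ny) (u : Signal nu) (p : Scheduling P)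
    (x₀ : Fin nx → ℝ) : ℝ≥0 → Fin nx → ℝ :=
  (exists_isMildSolution S u p x₀).choose

theorem isMildSolution_traj (S : LPVSSA P nx nu ny) (u : Signal nu) (p : Scheduling P)
    (x₀ : Fin nx → ℝ) : IsMildSolution S u p x₀ (traj S u p x₀) :=
  (exists_isMildSolution S u p x₀).choose_spec

/-- The output trajectory with initial state `x₀`. -/
noncomputable def output (S : LPVSSA P nx nu ny) (u : Signal nu) (p : Scheduling P)
    (x₀ : Fin nx → ℝ) : Signal ny :=
  ⟨fun t => S.outputMap (p.1 t) (traj S u p x₀ t) (u.1 t),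
    (piecewiseContinuousMap_triple u p (isMildSolution_traj S u p x₀).1).comp
      S.continuous_outputMap⟩

theorem forAlmostAll_iff (Q : ℝ≥0 → Prop) :
    ForAlmostAll Q ↔ ∀ᵐ s : ℝ, 0 ≤ s → Q s.toNNReal :=
  ae_restrict_iff' measurableSet_Ici

theorem ForAlmostAll.shift {Q : ℝ≥0 → Prop} (h : ForAlmostAll Q) (T : ℝ≥0) :
    ForAlmostAll fun t => Q (T + t) := by
  rw [forAlmostAll_iff] at h ⊢
  filter_upwards [(measurePreserving_add_left volume (T : ℝ)).quasiMeasurePreserving.ae h]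
    with s hs h0
  have h := hs (add_nonneg T.2 h0)
  rwa [Real.toNNReal_add T.coe_nonneg h0, Real.toNNReal_coe] at h

theorem continuous_stateTrajectory (x : StateTrajectory nx) : Continuous x.1 := by
  rw [continuous_iff_continuousAt]
  intro t
  have h := (x.2 (t + 1)).continuousOn
  rw [uIcc_of_le (NNReal.coe_nonneg _)] at h
  have hx : x.1 = fun s : ℝ≥0 => extend x.1 s := by
    funext s
    simp [extend]
  have hc : ContinuousOn (fun s : ℝ≥0 => extend x.1 s) (Iic (t + 1)) :=
    h.comp NNReal.continuous_coe.continuousOn fun s hs => ⟨s.2, NNReal.coe_le_coe.2 hs⟩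
  rw [hx]
  exact hc.continuousAt (Iic_mem_nhds (lt_add_one t))

/-- The trajectory minus the primitive of the right-hand side is absolutely continuous with
derivative zero almost everywhere, hence constant. -/
theorem isMildSolution_of_hasDerivAt (S : LPVSSA P nx nu ny) (u : Signal nu) (p : Scheduling P)
    (x : StateTrajectory nx) (h : ForAlmostAll fun t =>
      HasDerivAt (extend x.1) (S.stateMap (p.1 t) (x.1 t) (u.1 t)) (t : ℝ)) :
    IsMildSolution S u p (x.1 0) x.1 := by
  have hx := continuous_stateTrajectory x
  refine ⟨hx, fun t => ?_⟩
  have hI := locallyBoundedMeasurable_stateMap S u p hx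
  have hac := (x.2 t).sub (hI.absolutelyContinuousOnInterval (c := 0) (a := 0) (T := t)
    fun s _ => (zero_add _).symm)
  obtain ⟨C, hC⟩ := hac.const_of_ae_hasDerivAt_zero (by
    filter_upwards [(forAlmostAll_iff _).1 h, LocallyIntegrable.ae_hasDerivAt_integral hI.locallyIntegrable]
      with s h1 h2 hs
    rw [uIcc_of_le t.coe_nonneg] at hs
    have h3 := h1 hs.1
    rw [Real.coe_toNNReal s hs.1] at h3
    simpa using h3.sub (h2 0))
  have h0 := hC 0 left_mem_uIcc
  have ht := hC t right_mem_uIcc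
  simp only [Pi.sub_apply, extend, Real.toNNReal_zero, Real.toNNReal_coe,
    intervalIntegral.integral_same, sub_zero] at h0 ht
  rw [h0, ← ht]
  abel

/-- A mild solution is a state trajectory. -/
def IsMildSolution.toStateTrajectory {S : LPVSSA P nx nu ny} {u : Signal nu} {p : Scheduling P}
    {x₀ : Fin nx → ℝ} {x : ℝ≥0 → Fin nx → ℝ} (hx : IsMildSolution S u p x₀ x) :
    StateTrajectory nx :=
  ⟨x, fun T => (locallyBoundedMeasurable_stateMap S u p hx.1).absolutelyContinuousOnInterval
    (c := x₀) (a := 0) fun t ht => by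
      rw [uIcc_of_le T.coe_nonneg] at ht
      rw [extend, hx.2, Real.coe_toNNReal t ht.1]⟩

theorem IsMildSolution.hasDerivAt {S : LPVSSA P nx nu ny} {u : Signal nu} {p : Scheduling P}
    {x₀ : Fin nx → ℝ} {x : ℝ≥0 → Fin nx → ℝ} (hx : IsMildSolution S u p x₀ x) :
    ForAlmostAll fun t => HasDerivAt (extend x) (S.stateMap (p.1 t) (x t) (u.1 t)) (t : ℝ) := by
  rw [forAlmostAll_iff]
  -- Time `0` is discarded: the integral formula holds only to its right, whereas the derivative of
  -- `extend x` is two-sided.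
  filter_upwards [compl_mem_ae_iff.2 (measure_singleton (0 : ℝ)),
    LocallyIntegrable.ae_hasDerivAt_integral
      (locallyBoundedMeasurable_stateMap S u p hx.1).locallyIntegrable]
    with t h0 h ht
  have ht0 : 0 < t := lt_of_le_of_ne ht (Ne.symm h0)
  rw [Real.coe_toNNReal t ht]
  refine ((h 0).const_add x₀).congr_of_eventuallyEq ?_
  filter_upwards [Ioi_mem_nhds ht0] with s hs
  rw [extend, hx.2, Real.coe_toNNReal s (le_of_lt hs)]

/-- Solutions and mild solutions have the same states, so uniqueness determines the output up to a
null set, and every output in that class occurs. -/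
theorem exists_isSolution_iff (S : LPVSSA P nx nu ny) (y : Signal ny) (u : Signal nu)
    (p : Scheduling P) (x₀ : Fin nx → ℝ) :
    (∃ x : StateTrajectory nx, IsSolution S x y u p ∧ x.1 0 = x₀) ↔
      outputSetoid ny y (output S u p x₀) := by
  constructor
  · rintro ⟨x, hx, rfl⟩
    have hm := isMildSolution_of_hasDerivAt S u p x (Eventually.mono hx fun _ h => h.1)
    have heq := hm.unique (isMildSolution_traj S u p (x.1 0))
    refine Eventually.mono hx fun s h => ?_
    exact h.2.trans (congrArg (fun z => S.outputMap _ (z s.toNNReal) _) heq)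
  · intro h
    have hm := isMildSolution_traj S u p x₀
    exact ⟨hm.toStateTrajectory, hm.hasDerivAt.and h, hm.initial⟩

theorem isIOFunction_iff (S : LPVSSA P nx nu ny) (x₀ : Fin nx → ℝ)
    (F : Signal nu × Scheduling P → OutputClass ny) :
    IsIOFunction S x₀ F ↔ F = fun w => Quotient.mk _ (output S w.1 w.2 x₀) := by
  simp only [IsIOFunction, exists_isSolution_iff]
  constructor
  · intro h
    funext w
    exact ((h w.1 w.2 _).2 ((outputSetoid ny).refl _)).symm
  · rintro rfl u p y
    exact Quotient.eq

theorem ioFamily_eq_range (S : LPVSSA P nx nu ny) :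
    ioFamily S = range fun x₀ (w : Signal nu × Scheduling P) =>
      Quotient.mk (outputSetoid ny) (output S w.1 w.2 x₀) := by
  ext F
  simp only [ioFamily, isIOFunction_iff, mem_range, eq_comm]
  rfl

theorem mem_behavior_iff (S : LPVSSA P nx nu ny) (w : Signal ny × Signal nu × Scheduling P) :
    w ∈ behavior S ↔ ∃ x₀, outputSetoid ny w.1 (output S w.2.1 w.2.2 x₀) := by
  simp only [← exists_isSolution_iff]
  exact ⟨fun ⟨x, hx⟩ => ⟨x.1 0, x, hx, rfl⟩, fun ⟨_, x, hx, _⟩ => ⟨x, hx⟩⟩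

/-! ### Continuous time: superposition, concatenation, agreement -/

/-- The zero input. -/
def zeroSignal (n : ℕ) : Signal n :=
  ⟨fun _ => 0, PiecewiseContinuousMap.of_continuous continuous_const⟩

theorem traj_add_smul (S : LPVSSA P nx nu ny) (u : Signal nu) (p : Scheduling P)
    (x y : Fin nx → ℝ) (c : ℝ) :
    traj S u p (x + c • y) = traj S u p x + c • traj S (zeroSignal nu) p y := by
  refine (isMildSolution_traj S u p _).unique
    ((isMildSolution_traj S u p x).add_smul (isMildSolution_traj S (zeroSignal nu) p y) ?_)
  funext t
  simp [zeroSignal]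

theorem output_add_smul (S : LPVSSA P nx nu ny) (u : Signal nu) (p : Scheduling P)
    (x y : Fin nx → ℝ) (c : ℝ) (t : ℝ≥0) :
    (output S u p (x + c • y)).1 t =
      (output S u p x).1 t + c • (output S (zeroSignal nu) p y).1 t := by
  simp only [output, traj_add_smul]
  rw [← S.outputMap_add_smul]
  simp [zeroSignal]

theorem output_zero (S : LPVSSA P nx nu ny) (p : Scheduling P) (t : ℝ≥0) :
    (output S (zeroSignal nu) p 0).1 t = 0 := by
  simpa using output_add_smul S (zeroSignal nu) p 0 0 (-1) t

/-- Backward uniqueness makes the linear zero-input flow injective, and in finite dimension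
injective endomorphisms are onto. -/
theorem traj_zero_surjective (S : LPVSSA P nx nu ny) (p : Scheduling P) (t : ℝ≥0) :
    Function.Surjective fun x => traj S (zeroSignal nu) p x t := by
  have hlin := traj_add_smul S (zeroSignal nu) p
  have hzero : traj S (zeroSignal nu) p 0 = 0 := by
    simpa using hlin 0 0 (-1)
  let L : (Fin nx → ℝ) →ₗ[ℝ] (Fin nx → ℝ) :=
    { toFun := fun x => traj S (zeroSignal nu) p x t
      map_add' := fun x y => by simpa using congrFun (hlin x y 1) t
      map_smul' := fun c x => by simpa [hzero] using congrFun (hlin 0 x c) t }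
  refine (LinearMap.injective_iff_surjective (f := L)).1 fun x y h => ?_
  exact (isMildSolution_traj S _ p x).initial_eq (isMildSolution_traj S _ p y) h

/-- Concatenation of inputs. -/
noncomputable def concatSignal (T : ℝ≥0) (u v : Signal nu) : Signal nu :=
  ⟨concatAt T u.1 v.1, PiecewiseContinuousMap.concatAt u.2 v.2 T⟩

/-- Concatenation of scheduling signals. -/
noncomputable def concatScheduling (T : ℝ≥0) (p q : Scheduling P) : Scheduling P :=
  ⟨concatAt T p.1 q.1, PiecewiseContinuousMap.concatAt p.2.1 q.2.1 T, fun t => by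
    unfold concatAt
    split_ifs
    exacts [p.2.2 _, q.2.2 _]⟩

theorem traj_concat_of_le (S : LPVSSA P nx nu ny) (T : ℝ≥0) (u v : Signal nu)
    (p q : Scheduling P) (x : Fin nx → ℝ) {t : ℝ≥0} (ht : t ≤ T) :
    traj S (concatSignal T u v) (concatScheduling T p q) x t = traj S u p x t :=
  (isMildSolution_traj S _ _ x).eq_of_le (isMildSolution_traj S u p x)
    (fun _ => concatAt_of_lt _ _) (fun _ => concatAt_of_lt _ _) ht

theorem output_concat_of_lt (S : LPVSSA P nx nu ny) (T : ℝ≥0) (u v : Signal nu)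
    (p q : Scheduling P) (x : Fin nx → ℝ) {t : ℝ≥0} (ht : t < T) :
    (output S (concatSignal T u v) (concatScheduling T p q) x).1 t = (output S u p x).1 t := by
  simp only [output, traj_concat_of_le S T u v p q x ht.le]
  simp only [concatSignal, concatScheduling, concatAt_of_lt _ _ ht]

/-- After translation by `T` the trajectory is a mild solution for the second signals, started at
the state reached at `T`; uniqueness identifies it. -/
theorem output_concat_add (S : LPVSSA P nx nu ny) (T : ℝ≥0) (u v : Signal nu)
    (p q : Scheduling P) (x : Fin nx → ℝ) (t : ℝ≥0) :
    (output S (concatSignal T u v) (concatScheduling T p q) x).1 (T + t) =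
      (output S v q (traj S u p x T)).1 t := by
  have h := (isMildSolution_traj S (concatSignal T u v) (concatScheduling T p q) x).shift
    (v := v) (q := q) (fun t => concatAt_add _ _ _ t) (fun t => concatAt_add _ _ _ t)
  rw [traj_concat_of_le S T u v p q x le_rfl] at h
  have heq := congrFun (h.unique (isMildSolution_traj S v q _)) t
  simp only [output, heq]
  simp only [concatSignal, concatScheduling, concatAt_add]

/-- The pairs of initial states whose outputs agree almost everywhere before time `t`. -/
def agree (S : LPVSSA P nx nu ny) (S' : LPVSSA P nx' nu ny) (u : Signal nu) (p : Scheduling P)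
    (t : ℝ≥0) : Set ((Fin nx → ℝ) × (Fin nx' → ℝ)) :=
  {a | ForAlmostAll fun s => s < t → (output S u p a.1).1 s = (output S' u p a.2).1 s}

theorem mem_agree_iff {S : LPVSSA P nx nu ny} {S' : LPVSSA P nx' nu ny} {u : Signal nu}
    {p : Scheduling P} {t : ℝ≥0} {a : (Fin nx → ℝ) × (Fin nx' → ℝ)} :
    a ∈ agree S S' u p t ↔
      ForAlmostAll fun s => s < t → (output S u p a.1).1 s = (output S' u p a.2).1 s :=
  Iff.rfl

theorem agree_add_smul {S : LPVSSA P nx nu ny} {S' : LPVSSA P nx' nu ny} {u : Signal nu}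
    {p : Scheduling P} {t : ℝ≥0} {a b : (Fin nx → ℝ) × (Fin nx' → ℝ)} (c : ℝ)
    (ha : a ∈ agree S S' u p t) (hb : b ∈ agree S S' (zeroSignal nu) p t) :
    a + c • b ∈ agree S S' u p t := by
  rw [mem_agree_iff] at *
  refine (Eventually.and ha hb).mono fun s h hs => ?_
  simp only [Prod.fst_add, Prod.smul_fst, Prod.snd_add, Prod.smul_snd, output_add_smul, h.1 hs,
    h.2 hs]

theorem concatSignal_zero (T : ℝ≥0) (n : ℕ) :
    concatSignal T (zeroSignal n) (zeroSignal n) = zeroSignal n :=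
  Subtype.ext (concatAt_self_const T 0)

theorem agree_concat_subset (S : LPVSSA P nx nu ny) (S' : LPVSSA P nx' nu ny) (T t : ℝ≥0)
    (u v : Signal nu) (p q : Scheduling P) :
    agree S S' (concatSignal T u v) (concatScheduling T p q) (T + t) ⊆ agree S S' u p T := by
  intro a ha
  rw [mem_agree_iff] at *
  refine Eventually.mono ha fun s h hs => ?_
  simpa only [output_concat_of_lt _ _ _ _ _ _ _ hs] using h (hs.trans_le le_self_add)

theorem traj_mem_agree (S : LPVSSA P nx nu ny) (S' : LPVSSA P nx' nu ny) {T t : ℝ≥0}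
    {u v : Signal nu} {p q : Scheduling P} {a : (Fin nx → ℝ) × (Fin nx' → ℝ)}
    (ha : a ∈ agree S S' (concatSignal T u v) (concatScheduling T p q) (T + t)) :
    (traj S u p a.1 T, traj S' u p a.2 T) ∈ agree S S' v q t := by
  rw [mem_agree_iff] at *
  refine (ha.shift T).mono fun s h hs => ?_
  simpa only [output_concat_add] using h (add_lt_add_right hs T)

/-- Integer horizons suffice, so only countably many null sets are discarded. -/
theorem outputSetoid_of_forall_mem_agree {S : LPVSSA P nx nu ny} {S' : LPVSSA P nx' nu ny}
    {u : Signal nu} {p : Scheduling P} {a : (Fin nx → ℝ) × (Fin nx' → ℝ)}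
    (h : ∀ t, a ∈ agree S S' u p t) :
    outputSetoid ny (output S u p a.1) (output S' u p a.2) := by
  have : ∀ᵐ s ∂(volume.restrict (Ici (0 : ℝ))), ∀ n : ℕ, s.toNNReal < (n : ℝ≥0) →
      (output S u p a.1).1 s.toNNReal = (output S' u p a.2).1 s.toNNReal :=
    ae_all_iff.2 fun n => mem_agree_iff.1 (h n)
  refine this.mono fun s hs => ?_
  obtain ⟨n, hn⟩ := exists_nat_gt s.toNNReal
  exact hs n hn

theorem ioFamily_subset_of_behavior_eq (S : LPVSSA P nx nu ny) (S' : LPVSSA P nx' nu ny)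
    (hP : P.Nonempty) (h : behavior S = behavior S') : ioFamily S ⊆ ioFamily S' := by
  have : Nonempty (Scheduling P) :=
    ⟨⟨fun _ => hP.some, PiecewiseContinuousMap.of_continuous continuous_const,
      fun _ => hP.some_mem⟩⟩
  rw [ioFamily_eq_range, ioFamily_eq_range]
  rintro _ ⟨x₀, rfl⟩
  obtain ⟨x₀', h'⟩ := exists_uniform_partner (agree S S') (zeroSignal nu)
    (fun p t x => traj S (zeroSignal nu) p x t) (fun p t x => traj S' (zeroSignal nu) p x t)
    (fun p t => mem_agree_iff.2 (Eventually.of_forall fun s _ =>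
      (output_zero S p _).trans (output_zero S' p _).symm))
    (fun u q t a b c ha hb => agree_add_smul c ha hb)
    (fun p T u q t => by
      refine ⟨concatSignal T (zeroSignal nu) u, concatScheduling T p q, T + t, ?_,
        agree_concat_subset _ _ _ _ _ _ _ _, fun a ha => traj_mem_agree S S' ha⟩
      have := agree_concat_subset S S' T t (zeroSignal nu) (zeroSignal nu) p q
      rwa [concatSignal_zero] at this)
    (fun u p x => by
      have : (output S u p x, u, p) ∈ behavior S' := by
        rw [← h, mem_behavior_iff]
        exact ⟨x, (outputSetoid ny).refl _⟩
      obtain ⟨x', hx'⟩ := (mem_behavior_iff _ _).1 this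
      exact ⟨x', fun t => mem_agree_iff.2 (Eventually.mono hx' fun s hs _ => hs)⟩)
    (traj_zero_surjective S) x₀
  refine ⟨x₀', ?_⟩
  funext w
  exact (Quotient.sound (outputSetoid_of_forall_mem_agree (h' w.1 w.2))).symm

theorem behavior_subset_of_ioFamily_eq (S : LPVSSA P nx nu ny) (S' : LPVSSA P nx' nu ny)
    (h : ioFamily S = ioFamily S') : behavior S ⊆ behavior S' := by
  intro w hw
  obtain ⟨x₀, hx₀⟩ := (mem_behavior_iff _ _).1 hw
  rw [ioFamily_eq_range, ioFamily_eq_range] at h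
  obtain ⟨x₀', hx₀'⟩ := h.subset ⟨x₀, rfl⟩
  rw [mem_behavior_iff]
  exact ⟨x₀', (outputSetoid ny).trans hx₀ (Quotient.exact (congrFun hx₀' w.2).symm)⟩

theorem ioFamily_eq_iff_behavior_eq (S : LPVSSA P nx nu ny) (S' : LPVSSA P nx' nu ny)
    (hP : P.Nonempty) : ioFamily S = ioFamily S' ↔ behavior S = behavior S' :=
  ⟨fun h => (behavior_subset_of_ioFamily_eq S S' h).antisymm
      (behavior_subset_of_ioFamily_eq S' S h.symm),
    fun h => (ioFamily_subset_of_behavior_eq S S' hP h).antisymm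
      (ioFamily_subset_of_behavior_eq S' S hP h.symm)⟩

end CT

theorem mainTheorem1 :
    -- continuous time
    (∀ {np nx nx' nu ny : ℕ} (P : Set (Fin np → ℝ))
      (S : LPVSSA P nx nu ny) (S' : LPVSSA P nx' nu ny),
      CT.RC S → CT.RC S' → (CT.ioFamily S = CT.ioFamily S' ↔ CT.behavior S = CT.behavior S')) ∧
    -- discrete time
    (∀ {np nx nx' nu ny : ℕ} (P : Set (Fin np → ℝ))
      (S : LPVSSA P nx nu ny) (S' : LPVSSA P nx' nu ny),
      DT.RC S → DT.RC S' → (DT.ioFamily S = DT.ioFamily S' ↔ DT.behavior S = DT.behavior S')) ∧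
    -- the equivalence fails in discrete time when only one of the two systems satisfies RC
    (∀ nu : ℕ, ¬ DT.RC (DT.exampleSystem nu) ∧ DT.RC (DT.exampleSystem' nu) ∧
      DT.behavior (DT.exampleSystem nu) = DT.behavior (DT.exampleSystem' nu) ∧
      DT.ioFamily (DT.exampleSystem nu) ≠ DT.ioFamily (DT.exampleSystem' nu)) := by
  refine ⟨fun P S S' hS _ => CT.ioFamily_eq_iff_behavior_eq S S' (hS.2.mono interior_subset),
    fun P S S' => DT.ioFamily_eq_iff_behavior_eq S S', fun nu => ?_⟩
  exact ⟨DT.not_rc_exampleSystem nu, DT.rc_exampleSystem' nu, DT.behavior_exampleSystem_eq nu,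
    DT.ioFamily_exampleSystem_ne nu⟩
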